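/- Conventions. Ordinals are identified with the sets of their predecessors; in particular $\omega=\mathbb N$, and $\omega_1$ is the first uncountable ordinal. For an ordinal or set $\theta$, a function $c:[\omega_1]^2\to\theta$ is regarded as a function assigning a value $c(\alpha,\beta)\in\theta$ to each pair $\alpha<\beta<\omega_1$. For $k<\omega$, $[\omega_1]^k$ is the set of all $k$-element subsets of $\omega_1$, and $[\omega_1]^{<\aleph_0}=\bigcup_{k<\omega}[\omega_1]^k$. For a finite $a\subseteq\omega_1$, $a(n)$ denotes the $n$-th element of $a$ in increasing order (starting with $n=0$), and for $a,b\in[\omega_1]^{<\aleph_0}$, $a<b$ means that $\alpha<\beta$ for all $\alpha\in a$, $\beta\in b$. A function $c:[\omega_1]^2\to\theta$ has finite-to-one fibers if $\{\alpha<\beta\mid c(\alpha,\beta)=j\}$ is finite for all $\beta<\omega_1$ and $j\in\theta$. A partition $p:[\omega_1]^2\to\omega$ is $\ell_\infty$-coherent if $\{p(\alpha,\beta)-p(\alpha,\beta')\mid\alpha<\beta\}$ is a finite set of integers for all $\beta<\beta'<\omega_1$. Finally, $\mathrm{non}(\mathcal M)$ is the least cardinality of a nonmeager set of reals. Theorem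 (ZFC). The following seven statements are equivalent: 1. $\mathrm{non}(\mathcal M)=\aleph_1$. 2. There is a sequence $\langle f_m\mid m<\omega\rangle$ of functions from $\omega_1$ to $\omega_1$ such that for every cofinal $B\subseteq\omega_1$ there is $m<\omega$ with $f_m[B]=\omega_1$. 3. There is a sequence $\langle g_n\mid n<\omega\rangle$ of functions from $\omega_1$ to $\omega_1$ such that for every uncountable pairwise disjoint family $\mathcal B\subseteq[\omega_1]^{<\aleph_0}$ there are infinitely many $n<\omega$ such that for every $\gamma<\omega_1$ there is $b\in\mathcal B$ with $g_n[b]=\{\gamma\}$. 4. There is a coloring $c:[\omega_1]^2\to\omega_1\times\omega$ with finite-to-one fibers such that for all $k,l<\omega$, every infinite pairwise disjoint family $\mathcal A\subseteq[\omega_1]^k$ and every uncountable pairwise disjoint family $\mathcal B\subseteq[\omega_1]^l$, there is $a\in\mathcal A$ such that for every $\delta<\omega_1$ there are $\iota<\omega$ and $b\in\mathcal B$ with $$\{\alpha<\beta\mid c(\alpha,\beta)=(\delta,\iota)\}=a\quad\text{for every }\beta\in b.$$ 5. For every $\ell_\infty$-coherent partition $p:[\omega_1]^2\to\omega$ there is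 a coloring $d:[\omega_1]^2\to\omega_1$ such that for all $k,l<\omega$, every infinite pairwise disjoint family $\mathcal A\subseteq[\omega_1]^k$ and every uncountable pairwise disjoint family $\mathcal B\subseteq[\omega_1]^l$, there is $a\in\mathcal A$ such that for every matrix $\langle\tau_{n,m}\mid n<k,\ m<l\rangle$ of functions from $\omega$ to $\omega_1$ there is $b\in\mathcal B$ with $a<b$ and $$d(a(n),b(m))=\tau_{n,m}\bigl(p(a(n),b(m))\bigr)\quad\text{for all }n<k\text{ and }m<l.$$ 6. There is a coloring $e:[\omega_1]^2\to\omega$ such that for every infinite $A\subseteq\omega_1$ and every uncountable $B\subseteq\omega_1$ there is $\alpha\in A$ with $\{e(\alpha,\beta)\mid\beta\in B,\ \beta>\alpha\}=\omega$. 7. There is a set $X\subseteq{}^\omega\omega$ of cardinality $\aleph_1$ such that for every $y:\omega\to\omega$ there is $x\in X$ for which $\{n<\omega\mid x(n)=y(n)\}$ is infinite. -/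

import Mathlib

open scoped Ordinal Cardinal

/-- The ordinal `ω₁`, as a well-ordered type. -/
abbrev Omega1 : Type := (ω₁ : Ordinal.{0}).ToType

/- A function on `[ω₁]²` is represented by a function `c : Omega1 → Omega1 → θ`, of which only the
values `c α β` with `α < β` are ever used. -/

/-- `non(M)`: the least cardinality of a nonmeager set of reals. -/
noncomputable def nonMeager : Cardinal.{0} :=
  sInf {κ | ∃ X : Set ℝ, ¬ IsMeagre X ∧ Cardinal.mk X = κ}

/-- `c : [ω₁]² → θ` has finite-to-one fibers. -/
def HasFiniteToOneFibers {θ : Type} (c : Omega1 → Omega1 → θ) : Prop :=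
  ∀ (β : Omega1) (j : θ), {α : Omega1 | α < β ∧ c α β = j}.Finite

/-- `p : [ω₁]² → ω` is `ℓ_∞`-coherent; the differences are taken in `ℤ`. -/
def IsLInftyCoherent (p : Omega1 → Omega1 → ℕ) : Prop :=
  ∀ β β' : Omega1, β < β' →
    {z : ℤ | ∃ α : Omega1, α < β ∧ z = (p α β : ℤ) - (p α β' : ℤ)}.Finite

/-- A family of pairwise disjoint finite subsets of `ω₁`. -/
def DisjointFamily (A : Set (Finset Omega1)) : Prop :=
  ∀ a ∈ A, ∀ b ∈ A, a ≠ b → Disjoint a b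

/-- A family of pairwise disjoint `k`-element subsets of `ω₁`. -/
structure DisjointFamilyOfSize (k : ℕ) (A : Set (Finset Omega1)) : Prop where
  card_eq : ∀ a ∈ A, a.card = k
  disjoint : DisjointFamily A

/-- `a < b`: every element of `a` is below every element of `b`. -/
def BlockLT (a b : Finset Omega1) : Prop :=
  ∀ α ∈ a, ∀ β ∈ b, α < β

/-- Sierpiński's onto mapping principle. -/
def SierpinskiPrinciple : Prop :=
  ∃ f : ℕ → Omega1 → Omega1, ∀ B : Set Omega1, IsCofinal B →
    ∃ m : ℕ, f m '' B = Set.univ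

/-- The version of the onto mapping principle for families of finite sets. -/
def SierpinskiPrincipleFinite : Prop :=
  ∃ g : ℕ → Omega1 → Omega1, ∀ B : Set (Finset Omega1), ¬ B.Countable → DisjointFamily B →
    {n : ℕ | ∀ γ : Omega1, ∃ b ∈ B, g n '' (b : Set Omega1) = {γ}}.Infinite

/-- The coloring `c : [ω₁]² → ω₁ × ω` of high-dimensional Galvin type. -/
def GalvinColoring : Prop :=
  ∃ c : Omega1 → Omega1 → Omega1 × ℕ, HasFiniteToOneFibers c ∧
    ∀ (k l : ℕ) (A B : Set (Finset Omega1)),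
      A.Infinite → DisjointFamilyOfSize k A → ¬ B.Countable → DisjointFamilyOfSize l B →
      ∃ a ∈ A, ∀ δ : Omega1, ∃ ι : ℕ, ∃ b ∈ B, ∀ β ∈ b,
        {α : Omega1 | α < β ∧ c α β = (δ, ι)} = (a : Set Omega1)

/-- The strong coloring `d : [ω₁]² → ω₁` over a partition `p : [ω₁]² → ω`. For a finset `a` with
`k` elements, `a.orderEmbOfFin _ n` is the `n`-th element of `a` in increasing order. -/
def StrongColoringOver (p : Omega1 → Omega1 → ℕ) : Prop :=
  ∃ d : Omega1 → Omega1 → Omega1,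
    ∀ (k l : ℕ) (A B : Set (Finset Omega1)), A.Infinite → ¬ B.Countable →
      ∀ (hA : DisjointFamilyOfSize k A) (hB : DisjointFamilyOfSize l B),
      ∃ (a : Finset Omega1) (ha : a ∈ A), ∀ τ : Fin k → Fin l → ℕ → Omega1,
        ∃ (b : Finset Omega1) (hb : b ∈ B), BlockLT a b ∧ ∀ (n : Fin k) (m : Fin l),
          d (a.orderEmbOfFin (hA.card_eq a ha) n) (b.orderEmbOfFin (hB.card_eq b hb) m) =
            τ n m (p (a.orderEmbOfFin (hA.card_eq a ha) n)
              (b.orderEmbOfFin (hB.card_eq b hb) m))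

/-- The weak Erdős–Hajnal–Milner coloring `e : [ω₁]² → ω`. -/
def WeakEHMColoring : Prop :=
  ∃ e : Omega1 → Omega1 → ℕ, ∀ A B : Set Omega1, A.Infinite → ¬ B.Countable →
    ∃ α ∈ A, {n : ℕ | ∃ β ∈ B, α < β ∧ e α β = n} = Set.univ

/-- There is a set of `ℵ₁` functions from `ω` to `ω` such that every such function agrees
infinitely often with a member of the set. -/
def InfinitelyOftenEqualFamily : Prop :=
  ∃ X : Set (ℕ → ℕ), Cardinal.mk X = ℵ₁ ∧
    ∀ y : ℕ → ℕ, ∃ x ∈ X, {n : ℕ | x n = y n}.Infinite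

/-!
The seven statements are shown equivalent through the last one, `InfinitelyOftenEqualFamily`.

*Getting the colorings.* A family of `ℵ₁` functions, one of which agrees infinitely often with any
given `y : ℕ → ℕ`, also guesses sequences in any set `V` of size at most `ℵ₁`, because sequences in
`ω₁` are bounded and bounded subsets of `ω₁` are countable. Two devices turn this into a uniform
guess (`InfinitelyOftenEqualFamily.exists_uniform_guess`): countably many functions `h n` on `ω₁`
such that for every `γ : ℕ → V` there is `ξ` so that on *each* finite set above `ξ` infinitely many
`h n` take the constant value `γ n`. The first device lets the `ξ`-th guess at `m` be a list of
values, one for each of the first `m + 1` ways of choosing, for every `β`, a position in an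
enumeration of the predecessors of `β`; the second one is the separability of the product `ℕ ^ ω₁`,
by which one of countably many such choices makes all points of a finite set look up the same
`ξ`. The principle for families of finite sets is immediate: a sequence of missed values would
be guessed.

For the two colorings of pairs, what is guessed is the given disjoint family `A` together with the
supposed counterexamples. Since each `β` acts on its own guesses, wrong ones included, points may
have been used up before the right guess arrives. `InfinitelyOftenEqualFamily.exists_block_guess`
overcomes this by a count: the number of points used before stage `n` has a bound independent of
`β`, so a list of more than that many disjoint blocks contains a fresh one, for all the points of
a finite set at once. For a coloring over a coherent partition `p` a guess can only contain a finite
part of each function `τ`; coherence says that `p α β` differs from `p α β₀` by a bounded amount,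
which is why a finite part suffices.

*Going back.* The onto mapping principle gives functions `x β : ℕ → ℕ` such that no `y` is missed
everywhere by uncountably many of them. If each `x β` agreed with `y` only finitely often, then
uncountably many would do so on the same finite set, and changing `y` there would contradict this.
The category statement implies the existence of the family because comeagerly many reals yield a
function agreeing infinitely often with a given one (`residual_floor_inv_fract`). For the converse,
following Bartoszyński, the weak Erdős–Hajnal–Milner coloring guesses functions on any given
infinite subset of `ℕ`. Given dense open sets, for each position `n` some finite block of binary
digits placed there forces a real into the first `n + 1` of them (`exists_block_mem`). One function
of the family provides a partition of `ℕ` into blocks, infinitely many of them long enough, and a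
second one provides the digits on infinitely many of these blocks; so the `ℵ₁` reals
`blockReal x x'` form a nonmeager set.
-/

/-! ### The first uncountable ordinal -/

theorem mk_omega1 : #Omega1 = ℵ₁ := by simp [Omega1]

instance : Infinite Omega1 := by
  rw [Cardinal.infinite_iff, mk_omega1]; exact Cardinal.aleph0_le_aleph 1

instance : Uncountable Omega1 := by
  rw [← Cardinal.aleph0_lt_mk_iff, mk_omega1]; exact Cardinal.aleph0_lt_aleph_one

noncomputable instance : Inhabited Omega1 := Classical.inhabited_of_nonempty inferInstance

theorem countable_Iio_omega1 (β : Omega1) : (Set.Iio β).Countable := by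
  rw [← Cardinal.le_aleph0_iff_set_countable, ← Order.lt_succ_iff, Cardinal.succ_aleph0]
  have h : #(Set.Iio β) < #Omega1 := Cardinal.mk_Iio_lt β (by simp [Omega1])
  rwa [mk_omega1] at h

theorem countable_Iic_omega1 (β : Omega1) : (Set.Iic β).Countable := by
  rw [← Set.Iio_insert]
  exact (countable_Iio_omega1 β).insert β

/-- Countable subsets of `ω₁` are strictly bounded. -/
theorem exists_forall_lt_of_countable {S : Set Omega1} (hS : S.Countable) :
    ∃ ξ, ∀ α ∈ S, α < ξ := by
  by_contra! h
  refine Set.not_countable_univ (α := Omega1) ?_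
  refine (hS.biUnion fun α _ => countable_Iic_omega1 α).mono fun ξ _ => ?_
  obtain ⟨α, hα, hξ⟩ := h ξ
  exact Set.mem_biUnion hα hξ

theorem exists_forall_le {ι : Type*} [Countable ι] (f : ι → Omega1) : ∃ ξ, ∀ i, f i ≤ ξ := by
  obtain ⟨ξ, hξ⟩ := exists_forall_lt_of_countable (Set.countable_range f)
  exact ⟨ξ, fun i => (hξ _ ⟨i, rfl⟩).le⟩

theorem isCofinal_of_not_countable {B : Set Omega1} (hB : ¬ B.Countable) : IsCofinal B := by
  intro ξ
  by_contra! h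
  exact hB ((countable_Iio_omega1 ξ).mono fun α hα => h α hα)

theorem not_countable_of_isCofinal {B : Set Omega1} (hB : IsCofinal B) : ¬ B.Countable := by
  intro h
  obtain ⟨ξ, hξ⟩ := exists_forall_lt_of_countable h
  obtain ⟨α, hα, hle⟩ := hB ξ
  exact (hξ α hα).not_ge hle

/-- An uncountable disjoint family has a nonempty member above any given `ξ`, since only countably
many of its members meet a given countable set. -/
theorem exists_mem_forall_lt {B : Set (Finset Omega1)} (hB : ¬ B.Countable)
    (hd : DisjointFamily B) (ξ : Omega1) : ∃ b ∈ B, b.Nonempty ∧ ∀ β ∈ b, ξ < β := by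
  by_contra! h
  apply hB
  have hsub : B ⊆ insert ∅ (⋃ β ∈ Set.Iic ξ, {b ∈ B | β ∈ b}) := by
    intro b hb
    rcases b.eq_empty_or_nonempty with rfl | hne
    · exact Set.mem_insert _ _
    · obtain ⟨β, hβ, hle⟩ := h b hb hne
      exact Set.mem_insert_of_mem _ (Set.mem_biUnion hle ⟨hb, hβ⟩)
  refine Set.Countable.mono hsub (Set.Countable.insert _ ?_)
  refine (countable_Iic_omega1 ξ).biUnion fun β _ => Set.Subsingleton.countable ?_
  rintro b ⟨hb, hβ⟩ b' ⟨hb', hβ'⟩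
  by_contra hne
  exact Finset.disjoint_left.1 (hd b hb b' hb' hne) hβ hβ'

/-- An enumeration of each closed initial segment of `ω₁`. -/
theorem exists_enumeration_Iic :
    ∃ E : Omega1 → ℕ → Omega1, ∀ β, Set.range (E β) = Set.Iic β := by
  have (β : Omega1) : ∃ f : ℕ → Omega1, Set.range f = Set.Iic β := by
    obtain ⟨f, hf⟩ := (countable_Iic_omega1 β).exists_eq_range ⟨β, Set.self_mem_Iic⟩
    exact ⟨f, hf.symm⟩
  choose E hE using this
  exact ⟨E, hE⟩

/-- An injection into `ℕ` of each initial segment of `ω₁`. -/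
theorem exists_injOn_Iio :
    ∃ r : Omega1 → Omega1 → ℕ, ∀ β, Set.InjOn (r β) (Set.Iio β) := by
  have (β : Omega1) : ∃ f : Omega1 → ℕ, Set.InjOn f (Set.Iio β) :=
    Set.countable_iff_exists_injOn.1 (countable_Iio_omega1 β)
  choose r hr using this
  exact ⟨r, hr⟩

theorem exists_surjective_of_mk_le {V : Type} [Nonempty V] (hV : #V ≤ ℵ₁) :
    ∃ π : Omega1 → V, Function.Surjective π := by
  rw [← mk_omega1] at hV
  obtain ⟨f⟩ := hV
  exact ⟨Function.invFun f, Function.invFun_surjective f.injective⟩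

/-! ### Guessing sequences of elements of a set of size at most `ℵ₁` -/

/-- A family of `ℵ₁` functions in `ω^ω` meeting every function infinitely often yields one for
functions into any `V` of size at most `ℵ₁`: a sequence in `ω₁` is bounded, hence is a sequence in
a countable set. -/
theorem InfinitelyOftenEqualFamily.exists_guess (H : InfinitelyOftenEqualFamily) {V : Type}
    [Nonempty V] (hV : #V ≤ ℵ₁) :
    ∃ z : Omega1 → ℕ → V, ∀ γ : ℕ → V, ∃ ξ, ∀ N, ∃ n ≥ N, z ξ n = γ n := by
  obtain ⟨X, hX, hXeq⟩ := H
  obtain ⟨π, hπ⟩ := exists_surjective_of_mk_le hV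
  obtain ⟨E, hE⟩ := exists_enumeration_Iic
  have : Nonempty X := by
    obtain ⟨x, hx, -⟩ := hXeq 0
    exact ⟨⟨x, hx⟩⟩
  obtain ⟨ρ, hρ⟩ := exists_surjective_of_mk_le (V := X × Omega1) (by
    simp [hX, Cardinal.mul_eq_self (Cardinal.aleph0_le_aleph 1)])
  refine ⟨fun ξ n => π (E (ρ ξ).2 ((ρ ξ).1.1 n)), fun γ => ?_⟩
  choose γ' hγ' using fun n => hπ (γ n)
  obtain ⟨δ, hδ⟩ := exists_forall_le γ'
  have (n : ℕ) : ∃ i, E δ i = γ' n := by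
    have : γ' n ∈ Set.range (E δ) := by rw [hE]; exact hδ n
    exact this
  choose y hy using this
  obtain ⟨x, hx, hinf⟩ := hXeq y
  obtain ⟨ξ, hξ⟩ := hρ (⟨x, hx⟩, δ)
  refine ⟨ξ, fun N => ?_⟩
  obtain ⟨n, hn, hN⟩ := hinf.exists_gt N
  refine ⟨n, hN.le, ?_⟩
  have hn : x n = y n := hn
  simp only [hξ, hn, hy, hγ']

/-- Countably many functions on `ω₁` realize every pattern on every finite set; this is the
separability of `W ^ ω₁` for a countable discrete `W`. -/
theorem exists_dense_sequence (W : Type) [Countable W] [Nonempty W] :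
    ∃ σ : ℕ → Omega1 → W, ∀ (b : Finset Omega1) (s : Omega1 → W), ∃ j, ∀ β ∈ b, σ j β = s β := by
  classical
  obtain ⟨r, hr⟩ : ∃ r : Omega1 → ℕ → Bool, Function.Injective r := by
    have : #Omega1 ≤ #(ℕ → Bool) := by
      rw [mk_omega1]
      simpa using Cardinal.aleph_one_le_continuum
    obtain ⟨f⟩ := this
    exact ⟨f, f.injective⟩
  obtain ⟨e, he⟩ := exists_surjective_nat (Σ k : ℕ, ((Fin k → Bool) → W))
  refine ⟨fun j β => (e j).2 fun i => r β i, fun b s => ?_⟩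
  -- Beyond `k` digits the points of `b` are told apart.
  obtain ⟨k, hk⟩ : ∃ k, ∀ β ∈ b, ∀ β' ∈ b, (∀ i < k, r β i = r β' i) → β = β' := by
    have (p : Omega1 × Omega1) : ∃ k, (∀ i < k, r p.1 i = r p.2 i) → p.1 = p.2 := by
      by_cases h : p.1 = p.2
      · exact ⟨0, fun _ => h⟩
      · obtain ⟨i, hi⟩ := Function.ne_iff.1 (hr.ne h)
        exact ⟨i + 1, fun h' => absurd (h' i (Nat.lt_succ_self i)) hi⟩
    choose k hk using this
    refine ⟨(b ×ˢ b).sup k, fun β hβ β' hβ' h => hk (β, β') fun i hi => h i (hi.trans_le ?_)⟩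
    exact Finset.le_sup (f := k) (Finset.mk_mem_product hβ hβ')
  have hL : ∃ L : (Fin k → Bool) → W, ∀ β ∈ b, L (fun i => r β i) = s β := by
    have hinj : Function.Injective fun (β : b) (i : Fin k) => r β i := by
      intro β β' h
      exact Subtype.ext (hk _ β.2 _ β'.2 fun i hi => congrFun h ⟨i, hi⟩)
    refine ⟨Function.extend (fun (β : b) (i : Fin k) => r β i) (fun β => s β)
      fun _ => Classical.arbitrary W, fun β hβ => ?_⟩
    exact hinj.extend_apply (fun β : b => s β) _ ⟨β, hβ⟩
  obtain ⟨L, hL⟩ := hL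
  obtain ⟨j, hj⟩ := he ⟨k, L⟩
  refine ⟨j, fun β hβ => ?_⟩
  change (fun p : Σ k : ℕ, ((Fin k → Bool) → W) => p.2 fun i => r β i) (e j) = s β
  rw [hj]
  exact hL β hβ

/-- A single sequence of functions on `ω₁` guesses every sequence in `V` on all finite sets above
some `ξ`, simultaneously at all points of the finite set and together with a label of each of its
points.

The stage `n` codes a pair `(m, j)`, where `j` is an index of a dense sequence of functions on
`ω₁`. The `j`-th function supplies each `β` with its label and with the position of `ξ` in the
enumeration of the predecessors of `β`, and the `ξ`-th guess at `m` is a list long enough to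
contain what is to be guessed at stage `(m, j)`. -/
theorem InfinitelyOftenEqualFamily.exists_uniform_guess (H : InfinitelyOftenEqualFamily)
    {V : Type} [Nonempty V] (hV : #V ≤ ℵ₁) :
    ∃ h : ℕ → Omega1 → V × ℕ, ∀ γ : ℕ → V, ∃ ξ, ∀ b : Finset Omega1, (∀ β ∈ b, ξ < β) →
      ∀ (s : Omega1 → ℕ) (N : ℕ), ∃ n ≥ N, ∀ β ∈ b, h n β = (γ n, s β) := by
  obtain ⟨E, hE⟩ := exists_enumeration_Iic
  obtain ⟨σ, hσ⟩ := exists_dense_sequence (ℕ × ℕ)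
  obtain ⟨z, hz⟩ := H.exists_guess (V := List V)
    ((Cardinal.mk_list_le_max V).trans (max_le (Cardinal.aleph0_le_aleph 1) hV))
  refine ⟨fun n β => ((z (E β (σ n.unpair.2 β).1) n.unpair.1).getD n.unpair.2
    (Classical.arbitrary V), (σ n.unpair.2 β).2), fun γ => ?_⟩
  obtain ⟨ξ, hξ⟩ := hz fun m => (List.range (m + 1)).map fun j => γ (Nat.pair m j)
  refine ⟨ξ, fun b hb s N => ?_⟩
  have (β : Omega1) : ∃ i, β ∈ b → E β i = ξ := by
    by_cases hβ : β ∈ b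
    · have : ξ ∈ Set.range (E β) := by rw [hE]; exact (hb β hβ).le
      obtain ⟨i, hi⟩ := this
      exact ⟨i, fun _ => hi⟩
    · exact ⟨0, fun h => absurd h hβ⟩
  choose i hi using this
  obtain ⟨j, hj⟩ := hσ b fun β => (i β, s β)
  obtain ⟨m, hm, hzm⟩ := hξ (max j N)
  refine ⟨Nat.pair m j, ((le_max_right j N).trans hm).trans (Nat.left_le_pair m j),
    fun β hβ => ?_⟩
  have hjm : j < m + 1 := Nat.lt_succ_of_le ((le_max_left j N).trans hm)
  simp only [Nat.unpair_pair, hj β hβ, hi β hβ, hzm]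
  simp [List.getD, hjm]

/-! ### Guessing finite blocks -/

/-- A bound for the number of points covered before stage `n`, when the blocks listed at stage `m`
are allowed to cover at most `m * (m * coveredBound m + 1)` points. At stage `n` there is then room
for more than `n * coveredBound n` blocks of size at most `n`. -/
def coveredBound : ℕ → ℕ
  | 0 => 0
  | n + 1 => coveredBound n + n * (n * coveredBound n + 1)

theorem card_biUnion_range_le_coveredBound {W : ℕ → Finset Omega1}
    (hW : ∀ n, (W n).card ≤ n * (n * coveredBound n + 1)) (n : ℕ) :
    ((Finset.range n).biUnion W).card ≤ coveredBound n := by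
  induction n with
  | zero => simp [coveredBound]
  | succ n ih =>
    rw [Finset.range_add_one, Finset.biUnion_insert, coveredBound, add_comm]
    exact (Finset.card_union_le _ _).trans (add_le_add (hW n) ih)

/-- A finite set meets at most as many members of a disjoint sequence as it has elements. -/
theorem exists_disjoint_of_card_lt {a : ℕ → Finset Omega1}
    (ha : Pairwise fun i j => Disjoint (a i) (a j)) {F : Finset Omega1} {S : ℕ} (hF : F.card < S) :
    ∃ j < S, Disjoint (a j) F := by
  by_contra! h
  have (j : ℕ) : ∃ x, j < S → x ∈ a j ∧ x ∈ F := by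
    by_cases hj : j < S
    · obtain ⟨x, hx⟩ := Finset.not_disjoint_iff.1 (h j hj)
      exact ⟨x, fun _ => hx⟩
    · exact ⟨default, fun h' => absurd h' hj⟩
  choose x hx using this
  obtain ⟨i, hi, j, hj, hne, heq⟩ := Finset.exists_ne_map_eq_of_card_lt_of_maps_to
    (s := Finset.range S) (t := F) (by simpa using hF) (f := x)
    fun j hj => (hx j (Finset.mem_range.1 hj)).2
  have hi' := (hx i (Finset.mem_range.1 hi)).1
  rw [heq] at hi'
  exact Finset.disjoint_left.1 (ha hne) hi' (hx j (Finset.mem_range.1 hj)).1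

/-- Every infinite disjoint family of finite sets of a fixed size is guessed by finite-to-one
partial colorings `D · β` of the predecessors of `β`: at all points `β` of any high enough finite
set `b` simultaneously, some member `a` of the family is a full color class, and that color carries
the value `w a n` for an arbitrarily large `n` and a prescribed label of `β`.

At stage `n` each `β` guesses a list of blocks. The color of `α` is given by the first stage whose
list covers `α` and by the first block containing it. The number of points covered before stage
`n` is bounded in advance, so a correctly guessed list which is long enough contains a block that
has not been touched before by any of the points of `b`. -/
theorem InfinitelyOftenEqualFamily.exists_block_guess (H : InfinitelyOftenEqualFamily)
    {V : Type} [Nonempty V] (hV : #V ≤ ℵ₁) :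
    ∃ (D : Omega1 → Omega1 → Option ℕ) (G : ℕ → Omega1 → V × ℕ),
      (∀ β ι, {α | D α β = some ι}.Finite) ∧
      ∀ (k : ℕ) (A : Set (Finset Omega1)), A.Infinite → DisjointFamilyOfSize k A →
        ∀ w : Finset Omega1 → ℕ → V, ∃ ξ, ∀ b : Finset Omega1, (∀ β ∈ b, ξ < β) →
          ∀ (s : Omega1 → ℕ) (N : ℕ), ∃ n ≥ N, ∃ a ∈ A, ∃ ι, ∀ β ∈ b,
            {α | α < β ∧ D α β = some ι} = (a : Set Omega1) ∧ G ι β = (w a n, s β) := by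
  classical
  have hcard : #(List (Finset Omega1 × V)) ≤ ℵ₁ := by
    refine (Cardinal.mk_list_le_max _).trans (max_le (Cardinal.aleph0_le_aleph 1) ?_)
    simp only [Cardinal.mk_prod, Cardinal.lift_id, Cardinal.mk_finset_of_infinite, mk_omega1]
    exact (mul_le_mul_right hV _).trans
      (Cardinal.mul_eq_self (Cardinal.aleph0_le_aleph 1)).le
  obtain ⟨h, hh⟩ := H.exists_uniform_guess hcard
  let cover (L : List (Finset Omega1 × V)) : Finset Omega1 := L.toFinset.biUnion Prod.fst
  have mem_cover (L) (α) : α ∈ cover L ↔ ∃ x ∈ L, α ∈ x.1 := by simp [cover]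
  let L (n : ℕ) (β : Omega1) : List (Finset Omega1 × V) :=
    if (cover (h n β).1).card ≤ n * (n * coveredBound n + 1) then (h n β).1 else []
  have hL (n β) : (cover (L n β)).card ≤ n * (n * coveredBound n + 1) := by
    by_cases hc : (cover (h n β).1).card ≤ n * (n * coveredBound n + 1)
    · simp only [L, if_pos hc, hc]
    · simp [L, if_neg hc, cover]
  let D (α β : Omega1) : Option ℕ :=
    if hα : ∃ n, α ∈ cover (L n β) then
      some (Nat.pair (Nat.find hα) ((L (Nat.find hα) β).findIdx fun x => α ∈ x.1))
    else none
  have hD (α β : Omega1) (n j : ℕ) : D α β = some (Nat.pair n j) ↔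
      α ∈ cover (L n β) ∧ (∀ m < n, α ∉ cover (L m β)) ∧
        (L n β).findIdx (fun x => α ∈ x.1) = j := by
    by_cases hα : ∃ n, α ∈ cover (L n β)
    · simp only [D, dif_pos hα, Option.some_inj, Nat.pair_eq_pair]
      constructor
      · rintro ⟨rfl, hj⟩
        exact ⟨Nat.find_spec hα, fun m hm => Nat.find_min hα hm, hj⟩
      · rintro ⟨h₁, h₂, h₃⟩
        have : Nat.find hα = n := (Nat.find_eq_iff hα).2 ⟨h₁, h₂⟩
        exact ⟨this, by rw [this]; exact h₃⟩
    · simp only [D, dif_neg hα]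
      constructor
      · intro h; cases h
      · rintro ⟨h₁, -⟩
        exact absurd ⟨n, h₁⟩ hα
  refine ⟨D, fun ι β => ((((L ι.unpair.1 β)[ι.unpair.2]?).map Prod.snd).getD
    (Classical.arbitrary V), (h ι.unpair.1 β).2), fun β ι => ?_, ?_⟩
  · refine (cover (L ι.unpair.1 β)).finite_toSet.subset fun α hα => ?_
    have hα : D α β = some ι := hα
    rw [← Nat.pair_unpair ι, hD] at hα
    exact hα.1
  intro k A hA hAk w
  let a (j : ℕ) : Finset Omega1 := hA.natEmbedding A j
  have haA (j) : a j ∈ A := (hA.natEmbedding A j).2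
  have hdisj : Pairwise fun i j => Disjoint (a i) (a j) := fun i j hij =>
    hAk.disjoint _ (haA i) _ (haA j) fun h =>
      hij ((hA.natEmbedding A).injective (Subtype.ext h))
  obtain ⟨ξ₀, hξ₀⟩ := hh fun n =>
    (List.range (n * coveredBound n + 1)).map fun j => (a j, w (a j) n)
  obtain ⟨ξ₁, hξ₁⟩ := exists_forall_lt_of_countable
    (Set.countable_iUnion fun j => (a j).countable_toSet)
  refine ⟨max ξ₀ ξ₁, fun b hb s N => ?_⟩
  obtain ⟨n, hn, hguess⟩ := hξ₀ b (fun β hβ => (le_max_left _ _).trans_lt (hb β hβ)) s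
    (max N (max k b.card))
  have hN : N ≤ n := (le_max_left _ _).trans hn
  have hk : k ≤ n := (le_max_left _ _).trans ((le_max_right _ _).trans hn)
  have hbn : b.card ≤ n := (le_max_right _ _).trans ((le_max_right _ _).trans hn)
  set γ := (List.range (n * coveredBound n + 1)).map fun j => (a j, w (a j) n) with hγ
  have hcov : (cover γ).card ≤ n * (n * coveredBound n + 1) := by
    refine (Finset.card_biUnion_le_card_mul _ _ k fun x hx => ?_).trans ?_
    · obtain ⟨j, -, rfl⟩ := List.mem_map.1 (List.mem_toFinset.1 hx)
      exact (hAk.card_eq _ (haA j)).le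
    · rw [mul_comm]
      refine Nat.mul_le_mul hk ((List.toFinset_card_le _).trans ?_)
      simp [hγ]
  have hLγ (β) (hβ : β ∈ b) : L n β = γ := by
    simp only [L, hguess β hβ, if_pos hcov]
  obtain ⟨j, hj, hjF⟩ := exists_disjoint_of_card_lt hdisj
    (F := b.biUnion fun β => (Finset.range n).biUnion fun m => cover (L m β))
    (S := n * coveredBound n + 1) (by
      refine Nat.lt_succ_of_le ((Finset.card_biUnion_le_card_mul _ _ _ fun β _ =>
        card_biUnion_range_le_coveredBound (fun m => hL m β) n).trans ?_)
      exact Nat.mul_le_mul_right _ hbn)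
  refine ⟨n, hN, a j, haA j, Nat.pair n j, fun β hβ => ⟨?_, ?_⟩⟩
  · ext α
    simp only [Set.mem_ofPred_eq, hD, hLγ β hβ, Finset.mem_coe]
    constructor
    · rintro ⟨-, h₁, -, rfl⟩
      obtain ⟨x, hx, hαx⟩ := (mem_cover _ _).1 h₁
      have hlt := List.findIdx_lt_length_of_exists (p := fun x => decide (α ∈ x.1))
        ⟨x, hx, by simpa using hαx⟩
      have := List.findIdx_getElem (w := hlt)
      simpa [hγ] using this
    · intro hα
      refine ⟨(hξ₁ α (Set.mem_iUnion.2 ⟨j, hα⟩)).trans ((le_max_right _ _).trans_lt (hb β hβ)),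
        (mem_cover _ _).2 ⟨(a j, w (a j) n), List.mem_map.2 ⟨j, by simpa using hj, rfl⟩, hα⟩,
        fun m hm hαm => ?_, ?_⟩
      · exact Finset.disjoint_left.1 hjF hα (Finset.mem_biUnion.2 ⟨β, hβ,
          Finset.mem_biUnion.2 ⟨m, Finset.mem_range.2 hm, hαm⟩⟩)
      · rw [List.findIdx_eq (by simpa [hγ] using hj)]
        refine ⟨by simpa [hγ] using hα, fun i hi => ?_⟩
        have := Finset.disjoint_right.1 (hdisj hi.ne) hα
        simpa [hγ] using this
  · simp only [Nat.unpair_pair, hLγ β hβ, hguess β hβ]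
    simp [hγ, hj]

/-! ### The colorings obtained by guessing -/

theorem InfinitelyOftenEqualFamily.sierpinskiPrincipleFinite (H : InfinitelyOftenEqualFamily) :
    SierpinskiPrincipleFinite := by
  obtain ⟨h, hh⟩ := H.exists_uniform_guess mk_omega1.le
  refine ⟨fun n β => (h n β).1, fun B hB hd => ?_⟩
  by_contra hfin
  rw [Set.not_infinite] at hfin
  obtain ⟨N, hN⟩ := hfin.bddAbove
  -- A sequence of values missed by all but finitely many of the functions is guessed.
  have (n : ℕ) : ∃ γ, N < n → ∀ b ∈ B, (fun β => (h n β).1) '' (b : Set Omega1) ≠ {γ} := by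
    by_cases hn : N < n
    · have hnot : ¬ ∀ γ, ∃ b ∈ B, (fun β => (h n β).1) '' (b : Set Omega1) = {γ} :=
        fun hall => (hN hall).not_gt hn
      push Not at hnot
      exact hnot.imp fun γ hγ _ => hγ
    · exact ⟨default, fun h' => absurd h' hn⟩
  choose γ hγ using this
  obtain ⟨ξ, hξ⟩ := hh γ
  obtain ⟨b, hb, hne, hξb⟩ := exists_mem_forall_lt hB hd ξ
  obtain ⟨n, hn, heq⟩ := hξ b hξb (fun _ => 0) (N + 1)
  refine hγ n hn b hb ?_
  rw [Set.image_congr (g := fun _ => γ n) fun β hβ => by rw [heq β hβ]]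
  exact (Finset.coe_nonempty.2 hne).image_const _

theorem InfinitelyOftenEqualFamily.galvinColoring (H : InfinitelyOftenEqualFamily) :
    GalvinColoring := by
  obtain ⟨D, G, hfin, hDG⟩ := H.exists_block_guess mk_omega1.le
  obtain ⟨r, hr⟩ := exists_injOn_Iio
  -- Even second coordinates come from `D`, odd ones make the remaining pairs pairwise different.
  let c (α β : Omega1) : Omega1 × ℕ :=
    (D α β).elim (default, 2 * r β α + 1) fun ι => ((G ι β).1, 2 * ι)
  have hc (α β : Omega1) (δ : Omega1) (ι : ℕ) :
      c α β = (δ, 2 * ι) ↔ D α β = some ι ∧ (G ι β).1 = δ := by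
    cases hα : D α β with
    | none =>
      simp only [c, hα, Option.elim, Prod.mk.injEq]
      grind
    | some ι' =>
      simp only [c, hα, Option.elim, Prod.mk.injEq]
      grind
  refine ⟨c, fun β j => ?_, fun k l A B hA hAk hB hBl => ?_⟩
  · rcases Nat.even_or_odd' j.2 with ⟨ι, hι | hι⟩
    · refine (hfin β ι).subset fun α hα => ?_
      exact ((hc α β j.1 ι).1 (by rw [hα.2, ← hι])).1
    · refine Set.Subsingleton.finite ?_
      have key (α) (hα : c α β = j) : r β α = ι := by
        cases h : D α β with
        | none =>
          have : c α β = (default, 2 * r β α + 1) := by simp [c, h]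
          have := congrArg Prod.snd (this.symm.trans hα)
          grind
        | some ι' =>
          have : c α β = ((G ι' β).1, 2 * ι') := by simp [c, h]
          have := congrArg Prod.snd (this.symm.trans hα)
          grind
      rintro α ⟨hα, hcα⟩ α' ⟨hα', hcα'⟩
      exact hr β hα hα' ((key α hcα).trans (key α' hcα').symm)
  · by_contra! hno
    have (a : Finset Omega1) : ∃ δ, a ∈ A → ∀ ι : ℕ, ∀ b ∈ B, ∃ β ∈ b,
        {α : Omega1 | α < β ∧ c α β = (δ, ι)} ≠ (a : Set Omega1) := by
      by_cases ha : a ∈ A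
      · exact (hno a ha).imp fun δ hδ _ => hδ
      · exact ⟨default, fun h => absurd h ha⟩
    choose δ hδ using this
    obtain ⟨ξ, hξ⟩ := hDG k A hA hAk fun a _ => δ a
    obtain ⟨b, hb, -, hξb⟩ := exists_mem_forall_lt hB hBl.disjoint ξ
    obtain ⟨-, -, a, ha, ι, hι⟩ := hξ b hξb (fun _ => 0) 0
    obtain ⟨β, hβ, hne⟩ := hδ a ha (2 * ι) b hb
    refine hne ?_
    rw [← (hι β hβ).1]
    ext α
    simp [hc, (hι β hβ).2]

/-- A coloring of pairs recovers the index `n` of the `n`-th element `α` of `a` from `a` and `α` by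
counting. -/
theorem card_filter_lt_orderEmbOfFin {a : Finset Omega1} {k : ℕ} (h : a.card = k) (n : Fin k) :
    (a.filter (· < a.orderEmbOfFin h n)).card = n := by
  have : a.filter (· < a.orderEmbOfFin h n) =
      (Finset.Iio n).map (a.orderEmbOfFin h).toEmbedding := by
    ext α
    simp only [Finset.mem_filter, Finset.mem_map, Finset.mem_Iio, RelEmbedding.coe_toEmbedding]
    constructor
    · rintro ⟨hα, hlt⟩
      have : α ∈ Set.range (a.orderEmbOfFin h) := by rwa [Finset.range_orderEmbOfFin]
      obtain ⟨i, rfl⟩ := this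
      exact ⟨i, (a.orderEmbOfFin h).lt_iff_lt.1 hlt, rfl⟩
    · rintro ⟨i, hi, rfl⟩
      exact ⟨Finset.orderEmbOfFin_mem _ _ _, (a.orderEmbOfFin h).lt_iff_lt.2 hi⟩
  rw [this, Finset.card_map, Fin.card_Iio]

theorem InfinitelyOftenEqualFamily.strongColoringOver (H : InfinitelyOftenEqualFamily)
    {p : Omega1 → Omega1 → ℕ} (hp : IsLInftyCoherent p) : StrongColoringOver p := by
  classical
  -- A guess consists of the block and of a finite part of the graph of a matrix of functions.
  have hV : #(Finset Omega1 × Finset ((ℕ × ℕ × ℕ) × Omega1)) ≤ ℵ₁ := by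
    simp [Cardinal.mul_eq_self (Cardinal.aleph0_le_aleph 1)]
  obtain ⟨D, G, -, hDG⟩ := H.exists_block_guess hV
  let val (Γ : Finset ((ℕ × ℕ × ℕ) × Omega1)) (t : ℕ × ℕ × ℕ) : Omega1 :=
    if ht : ∃ x, (t, x) ∈ Γ then ht.choose else default
  have hval (τ : ℕ × ℕ × ℕ → Omega1) (s : Finset (ℕ × ℕ × ℕ)) (t) (ht : t ∈ s) :
      val (s.image fun t => (t, τ t)) t = τ t := by
    have hex : ∃ x, (t, x) ∈ s.image fun t => (t, τ t) := ⟨τ t, Finset.mem_image_of_mem _ ht⟩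
    have hx := hex.choose_spec
    simp only [val, dif_pos hex]
    obtain ⟨t', -, h'⟩ := Finset.mem_image.1 hx
    obtain ⟨h₁, h₂⟩ := Prod.ext_iff.1 h'
    simp only at h₁ h₂
    rw [← h₂, h₁]
  refine ⟨fun α β => (D α β).elim default fun ι =>
    val (G ι β).1.2 (((G ι β).1.1.filter (· < α)).card, (G ι β).2, p α β),
    fun k l A₀ B hA₀ hB hA₀k hBl => ?_⟩
  -- Passing to a countable subfamily makes its union bounded.
  obtain ⟨A, hAA₀, hA, hAc⟩ : ∃ A ⊆ A₀, A.Infinite ∧ A.Countable := by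
    refine ⟨Set.range fun j => (hA₀.natEmbedding A₀ j : Finset Omega1), ?_, ?_,
      Set.countable_range _⟩
    · rintro _ ⟨j, rfl⟩
      exact (hA₀.natEmbedding A₀ j).2
    · exact Set.infinite_range_of_injective
        (Subtype.val_injective.comp (hA₀.natEmbedding A₀).injective)
  have hAk : DisjointFamilyOfSize k A :=
    ⟨fun a ha => hA₀k.card_eq a (hAA₀ ha),
      fun a ha a' ha' => hA₀k.disjoint a (hAA₀ ha) a' (hAA₀ ha')⟩
  obtain ⟨β₀, hβ₀⟩ := exists_forall_lt_of_countable (hAc.biUnion fun a _ => a.countable_toSet)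
  replace hβ₀ (a) (ha : a ∈ A) (α) (hα : α ∈ a) : α < β₀ := hβ₀ α (Set.mem_biUnion ha hα)
  by_contra! hno
  have (a : Finset Omega1) : ∃ τ : Fin k → Fin l → ℕ → Omega1, ∀ ha : a ∈ A,
      ∀ b (hb : b ∈ B), BlockLT a b → ∃ (n : Fin k) (m : Fin l),
        (D (a.orderEmbOfFin (hAk.card_eq a ha) n) (b.orderEmbOfFin (hBl.card_eq b hb) m)).elim
          default (fun ι => val (G ι (b.orderEmbOfFin (hBl.card_eq b hb) m)).1.2
            (((G ι (b.orderEmbOfFin (hBl.card_eq b hb) m)).1.1.filter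
              (· < a.orderEmbOfFin (hAk.card_eq a ha) n)).card,
              (G ι (b.orderEmbOfFin (hBl.card_eq b hb) m)).2,
              p (a.orderEmbOfFin (hAk.card_eq a ha) n)
                (b.orderEmbOfFin (hBl.card_eq b hb) m))) ≠
          τ n m (p (a.orderEmbOfFin (hAk.card_eq a ha) n)
            (b.orderEmbOfFin (hBl.card_eq b hb) m)) := by
    by_cases ha : a ∈ A
    · exact (hno a (hAA₀ ha)).imp fun τ hτ _ => hτ
    · exact ⟨fun _ _ _ => default, fun h => absurd h ha⟩
  choose τ hτ using this
  let τ' (a : Finset Omega1) (t : ℕ × ℕ × ℕ) : Omega1 :=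
    if h : t.1 < k ∧ t.2.1 < l then τ a ⟨t.1, h.1⟩ ⟨t.2.1, h.2⟩ t.2.2 else default
  -- By coherence, `p α β` is at most `p α β₀ + n` for all `α < β₀` once `n` is large enough, so
  -- this window of arguments suffices.
  obtain ⟨ξ, hξ⟩ := hDG k A hA hAk fun a n => (a,
    (Finset.range k ×ˢ Finset.range l ×ˢ Finset.range (a.sup (p · β₀) + n + 1)).image
      fun t => (t, τ' a t))
  obtain ⟨b, hb, -, hξb⟩ := exists_mem_forall_lt hB hBl.disjoint (max ξ β₀)
  have hbound (β : Omega1) : ∃ N, β ∈ b → ∀ α < β₀, p α β ≤ p α β₀ + N := by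
    by_cases hβ : β ∈ b
    · obtain ⟨z, hz⟩ := (hp β₀ β ((le_max_right _ _).trans_lt (hξb β hβ))).bddBelow
      refine ⟨z.natAbs, fun _ α hα => ?_⟩
      have := hz ⟨α, hα, rfl⟩
      omega
    · exact ⟨0, fun h => absurd h hβ⟩
  choose N hN using hbound
  obtain ⟨n, hn, a, ha, ι, hι⟩ := hξ b (fun β hβ => (le_max_left _ _).trans_lt (hξb β hβ))
    (fun β => (b.filter (· < β)).card) (b.sup N)
  have hαβ (α) (hα : α ∈ a) (β) (hβ : β ∈ b) : α < β ∧ D α β = some ι := by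
    have : α ∈ {α | α < β ∧ D α β = some ι} := by rw [(hι β hβ).1]; exact hα
    exact this
  obtain ⟨i, m, hne⟩ := hτ a ha b hb fun α hα β hβ => (hαβ α hα β hβ).1
  refine hne ?_
  set α := a.orderEmbOfFin (hAk.card_eq a ha) i with hαdef
  set β := b.orderEmbOfFin (hBl.card_eq b hb) m with hβdef
  have hα : α ∈ a := Finset.orderEmbOfFin_mem _ _ _
  have hβ : β ∈ b := Finset.orderEmbOfFin_mem _ _ _
  simp only [(hαβ α hα β hβ).2, Option.elim, (hι β hβ).2]
  rw [hval, hαdef, card_filter_lt_orderEmbOfFin, ← hαdef, hβdef, card_filter_lt_orderEmbOfFin]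
  · simp [τ']
  · rw [hαdef, card_filter_lt_orderEmbOfFin, ← hαdef, hβdef, card_filter_lt_orderEmbOfFin, ← hβdef]
    simp only [Finset.mem_product, Finset.mem_range, Fin.is_lt, true_and]
    have h₁ := hN β hβ α (hβ₀ a ha α hα)
    have h₂ : p α β₀ ≤ a.sup (p · β₀) := Finset.le_sup (f := (p · β₀)) hα
    have h₃ : N β ≤ b.sup N := Finset.le_sup hβ
    omega

/-! ### Consequences of the colorings -/

theorem SierpinskiPrincipleFinite.sierpinskiPrinciple (H : SierpinskiPrincipleFinite) :
    SierpinskiPrinciple := by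
  obtain ⟨g, hg⟩ := H
  refine ⟨g, fun B hB => ?_⟩
  have hB' : ¬ ((fun β : Omega1 => ({β} : Finset Omega1)) '' B).Countable := fun h =>
    not_countable_of_isCofinal hB
      (Set.countable_of_injective_of_countable_image (Finset.singleton_injective.injOn) h)
  obtain ⟨n, hn⟩ := (hg _ hB' (by
    rintro _ ⟨α, -, rfl⟩ _ ⟨β, -, rfl⟩ hne
    simpa using hne)).nonempty
  refine ⟨n, Set.eq_univ_of_forall fun γ => ?_⟩
  obtain ⟨_, ⟨β, hβ, rfl⟩, h⟩ := hn γ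
  exact ⟨β, hβ, by simpa using h⟩

theorem disjointFamilyOfSize_singletons (B : Set Omega1) :
    DisjointFamilyOfSize 1 ((fun β : Omega1 => ({β} : Finset Omega1)) '' B) where
  card_eq := by
    rintro _ ⟨α, -, rfl⟩
    simp
  disjoint := by
    rintro _ ⟨α, -, rfl⟩ _ ⟨β, -, rfl⟩ hne
    simpa using hne

theorem GalvinColoring.sierpinskiPrinciple (H : GalvinColoring) : SierpinskiPrinciple := by
  obtain ⟨c, -, hc⟩ := H
  let ν := Infinite.natEmbedding Omega1
  refine ⟨fun n β => (c (ν n) β).1, fun B hB => ?_⟩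
  have hinf : ((fun β : Omega1 => ({β} : Finset Omega1)) '' Set.range ν).Infinite :=
    (Set.infinite_range_of_injective ν.injective).image Finset.singleton_injective.injOn
  have hB' : ¬ ((fun β : Omega1 => ({β} : Finset Omega1)) '' B).Countable := fun h =>
    not_countable_of_isCofinal hB
      (Set.countable_of_injective_of_countable_image (Finset.singleton_injective.injOn) h)
  obtain ⟨_, ⟨_, ⟨n, rfl⟩, rfl⟩, h⟩ := hc 1 1 _ _ hinf (disjointFamilyOfSize_singletons _) hB'
    (disjointFamilyOfSize_singletons _)
  refine ⟨n, Set.eq_univ_of_forall fun δ => ?_⟩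
  obtain ⟨ι, _, ⟨β, hβ, rfl⟩, hβn⟩ := h δ
  have : ν n ∈ {α : Omega1 | α < β ∧ c α β = (δ, ι)} := by
    rw [hβn β (Finset.mem_singleton_self β)]; simp
  exact ⟨β, hβ, congrArg Prod.fst this.2⟩

theorem StrongColoringOver.weakEHMColoring {p : Omega1 → Omega1 → ℕ} (H : StrongColoringOver p) :
    WeakEHMColoring := by
  obtain ⟨d, hd⟩ := H
  let ν := Infinite.natEmbedding Omega1
  refine ⟨fun α β => Function.invFun ν (d α β), fun A B hA hB => ?_⟩
  have hA' : ((fun β : Omega1 => ({β} : Finset Omega1)) '' A).Infinite :=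
    hA.image Finset.singleton_injective.injOn
  have hB' : ¬ ((fun β : Omega1 => ({β} : Finset Omega1)) '' B).Countable := fun h =>
    hB (Set.countable_of_injective_of_countable_image (Finset.singleton_injective.injOn) h)
  obtain ⟨_, ⟨α, hα, rfl⟩, h⟩ := hd 1 1 _ _ hA' hB' (disjointFamilyOfSize_singletons _)
    (disjointFamilyOfSize_singletons _)
  refine ⟨α, hα, Set.eq_univ_of_forall fun n => ?_⟩
  obtain ⟨_, ⟨β, hβ, rfl⟩, hlt, heq⟩ := h fun _ _ _ => ν n
  have := heq 0 0
  simp only [Finset.orderEmbOfFin_singleton] at this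
  refine ⟨β, hβ, hlt α (by simp) β (by simp), ?_⟩
  simp only [this]
  exact Function.leftInverse_invFun ν.injective n

theorem exists_subset_mk_eq_aleph_one {X : Set (ℕ → ℕ)} (hX : #X ≤ ℵ₁) :
    ∃ Y, X ⊆ Y ∧ #Y = ℵ₁ := by
  have h : (ℵ₁ : Cardinal) ≤ #(ℕ → ℕ) := by simpa using Cardinal.aleph_one_le_continuum
  obtain ⟨Z, hZ⟩ := Cardinal.le_mk_iff_exists_set.1 h
  refine ⟨X ∪ Z, Set.subset_union_left, le_antisymm ?_ ?_⟩
  · refine (Cardinal.mk_union_le _ _).trans ?_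
    rw [hZ, Cardinal.add_eq_right (Cardinal.aleph0_le_aleph 1) hX]
  · rw [← hZ]
    exact Cardinal.mk_le_mk_of_subset Set.subset_union_right

theorem SierpinskiPrinciple.infinitelyOftenEqualFamily (H : SierpinskiPrinciple) :
    InfinitelyOftenEqualFamily := by
  obtain ⟨f, hf⟩ := H
  let ν := Infinite.natEmbedding Omega1
  let x (β : Omega1) (n : ℕ) : ℕ := Function.invFun ν (f n β)
  obtain ⟨Y, hY, hYc⟩ := exists_subset_mk_eq_aleph_one (X := Set.range x)
    (Cardinal.mk_range_le.trans mk_omega1.le)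
  refine ⟨Y, hYc, fun y => ?_⟩
  by_contra! hno
  have hfin (β : Omega1) : {n | x β n = y n}.Finite :=
    hno (x β) (hY ⟨β, rfl⟩)
  -- Uncountably many `x β` agree with `y` at the same finite set `F` of places; changing `y`
  -- there gives a function met by none of them.
  obtain ⟨F, hF⟩ : ∃ F : Finset ℕ, ¬ {β | (hfin β).toFinset = F}.Countable := by
    by_contra! h
    refine Set.not_countable_univ (α := Omega1) ((Set.countable_iUnion h).mono fun β _ => ?_)
    exact Set.mem_iUnion.2 ⟨(hfin β).toFinset, rfl⟩
  obtain ⟨m, hm⟩ := hf _ (isCofinal_of_not_countable hF)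
  have key (β) (hβ : (hfin β).toFinset = F) : m ∈ F ↔ x β m = y m := by
    rw [← hβ]; simp
  obtain ⟨β, hβ, hβm⟩ := hm.ge (Set.mem_univ (ν (if m ∈ F then y m + 1 else y m)))
  have hx : x β m = if m ∈ F then y m + 1 else y m := by
    simp only [x, hβm]
    exact Function.leftInverse_invFun ν.injective _
  have := key β hβ
  by_cases hmF : m ∈ F
  · rw [if_pos hmF] at hx
    have := this.1 hmF
    omega
  · rw [if_neg hmF] at hx
    exact hmF (this.2 hx)

/-! ### From nonmeager sets to infinitely often equal functions -/

/-- The integer part of the inverse of the fractional part of `n * x`, decreased by one, agrees with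
`y n` for infinitely many `n`, for comeagerly many reals `x`: on every interval of length `1 / n`
the fractional part of `n * x` takes all values in `(0, 1)`. -/
theorem residual_floor_inv_fract (y : ℕ → ℕ) :
    {x : ℝ | {n : ℕ | ⌊(Int.fract (n * x))⁻¹⌋₊ - 1 = y n}.Infinite} ∈ residual ℝ := by
  let O (N : ℕ) : Set ℝ := ⋃ n ≥ N, ⋃ j : ℤ,
    {x | j + ((y n : ℝ) + 2)⁻¹ < n * x ∧ n * x < j + ((y n : ℝ) + 1)⁻¹}
  have hopen (N) : IsOpen (O N) := by
    refine isOpen_biUnion fun n _ => isOpen_iUnion fun j => ?_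
    exact (isOpen_lt continuous_const (continuous_const.mul continuous_id)).inter
      (isOpen_lt (continuous_const.mul continuous_id) continuous_const)
  have hdense (N) : Dense (O N) := by
    rw [Metric.dense_iff]
    intro x ε hε
    obtain ⟨M, hM⟩ := exists_nat_gt ε⁻¹
    set n := max N M with hn
    have hMn : ε⁻¹ < n := hM.trans_le (by exact_mod_cast le_max_right N M)
    have hn0 : (0 : ℝ) < n := (inv_pos.2 hε).trans hMn
    have h1 : ((y n : ℝ) + 2)⁻¹ < ((y n : ℝ) + 1)⁻¹ := by gcongr; norm_num
    obtain ⟨c, hc₁, hc₂⟩ := exists_between h1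
    have hc0 : 0 < c := lt_trans (by positivity) hc₁
    have hc3 : c < 1 :=
      hc₂.trans_le (inv_le_one_of_one_le₀ (by linarith [(y n).cast_nonneg (α := ℝ)]))
    have hx' : (n : ℝ) * ((⌊n * x⌋ + c) / n) = ⌊n * x⌋ + c := by field_simp
    refine ⟨(⌊n * x⌋ + c) / n, ?_, Set.mem_iUnion₂.2 ⟨n, le_max_left _ _,
      Set.mem_iUnion.2 ⟨⌊n * x⌋, ?_⟩⟩⟩
    · rw [Metric.mem_ball, Real.dist_eq]
      have h2 : (⌊n * x⌋ + c) / n - x = (c - Int.fract (n * x)) / n := by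
        rw [Int.fract]; field_simp; ring
      rw [h2, abs_div, abs_of_pos hn0, div_lt_iff₀ hn0]
      have h3 : |c - Int.fract (n * x)| < 1 := by
        rw [abs_lt]
        constructor <;> linarith [Int.fract_nonneg (n * x), Int.fract_lt_one (n * x)]
      have h4 : 1 < ε * n := by rwa [inv_lt_iff_one_lt_mul₀ hε, mul_comm] at hMn
      linarith
    · simp only [Set.mem_ofPred_eq, hx']
      constructor <;> linarith
  refine Filter.mem_of_superset (countable_iInter_mem.2 fun N =>
    residual_of_dense_open (hopen N) (hdense N)) fun x hx => ?_
  refine Set.infinite_of_forall_exists_gt fun N => ?_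
  obtain ⟨n, hn, hx⟩ := Set.mem_iUnion₂.1 (Set.mem_iInter.1 hx (N + 1))
  obtain ⟨j, h₁, h₂⟩ := Set.mem_iUnion.1 hx
  refine ⟨n, ?_, hn⟩
  have hk : (0 : ℝ) ≤ y n := Nat.cast_nonneg _
  have hfr : Int.fract (n * x) = n * x - j := by
    rw [Int.fract_eq_iff]
    refine ⟨?_, ?_, j, by ring⟩
    · linarith [inv_pos.2 (show (0 : ℝ) < y n + 2 by linarith)]
    · linarith [inv_le_one_of_one_le₀ (show (1 : ℝ) ≤ y n + 1 by linarith)]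
  have h₃ : ((y n : ℝ) + 2)⁻¹ < Int.fract (n * x) := by linarith
  have h₄ : Int.fract (n * x) < ((y n : ℝ) + 1)⁻¹ := by linarith
  have h₅ : 0 < Int.fract (n * x) := lt_trans (by positivity) h₃
  have : ⌊(Int.fract (n * x))⁻¹⌋₊ = y n + 1 := by
    rw [Nat.floor_eq_iff (by positivity)]
    push_cast
    constructor
    · exact ((lt_inv_comm₀ h₅ (by positivity)).1 h₄).le
    · have := (inv_lt_comm₀ (by positivity) h₅).1 h₃
      linarith
  simp only [Set.mem_ofPred_eq, this]
  rfl

theorem nonMeager_mem : ∃ X : Set ℝ, ¬ IsMeagre X ∧ #X = nonMeager :=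
  csInf_mem (s := {κ | ∃ X : Set ℝ, ¬ IsMeagre X ∧ #X = κ})
    ⟨_, Set.univ, not_isMeagre_of_isOpen isOpen_univ Set.univ_nonempty, rfl⟩

theorem aleph_one_le_nonMeager : ℵ₁ ≤ nonMeager := by
  obtain ⟨X, hX, hXc⟩ := nonMeager_mem
  rw [← hXc]
  by_contra h
  rw [not_le, ← Cardinal.succ_aleph0, Order.lt_succ_iff, Cardinal.le_aleph0_iff_set_countable] at h
  refine hX ?_
  rw [← Set.biUnion_of_singleton X]
  refine isMeagre_biUnion h fun x _ => IsNowhereDense.isMeagre ?_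
  simp [IsNowhereDense]

theorem infinitelyOftenEqualFamily_of_nonMeager (H : nonMeager = ℵ₁) :
    InfinitelyOftenEqualFamily := by
  obtain ⟨X, hX, hXc⟩ := nonMeager_mem
  obtain ⟨Y, hY, hYc⟩ := exists_subset_mk_eq_aleph_one
    (X := (fun (x : ℝ) (n : ℕ) => ⌊(Int.fract (n * x))⁻¹⌋₊ - 1) '' X)
    (Cardinal.mk_image_le.trans (hXc.trans H).le)
  refine ⟨Y, hYc, fun y => ?_⟩
  by_contra! hno
  refine hX (Filter.mem_of_superset (residual_floor_inv_fract y) fun x hx hxX => ?_)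
  exact hx (hno _ (hY ⟨x, hxX, rfl⟩))

/-! ### From the weak Erdős–Hajnal–Milner coloring to a nonmeager set -/

/-- The coloring gives `ℵ₁` functions in `ω^ω` such that any `f` agrees infinitely often with one of
them on a given infinite set `S`. In fact all but countably many of them have this property, as
uncountably many that miss `f` on `S` contradict the coloring. -/
theorem WeakEHMColoring.exists_guess (H : WeakEHMColoring) :
    ∃ x : Omega1 → ℕ → ℕ, ∀ (f : ℕ → ℕ) (S : Set ℕ), S.Infinite →
      ∃ β, ∀ N, ∃ n ∈ S, N ≤ n ∧ x β n = f n := by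
  obtain ⟨e, he⟩ := H
  let ν := Infinite.natEmbedding Omega1
  refine ⟨fun β n => e (ν n) β, fun f S hS => ?_⟩
  have hcount (N : ℕ) : {β | ∀ n ∈ S, N ≤ n → e (ν n) β ≠ f n}.Countable := by
    by_contra hB
    have hA : (ν '' (S \ Set.Iio N)).Infinite :=
      (hS.sdiff (Set.finite_Iio N)).image ν.injective.injOn
    obtain ⟨_, ⟨n, ⟨hn, hN⟩, rfl⟩, hα⟩ := he _ _ hA hB
    obtain ⟨β, hβ, -, hβn⟩ := hα.ge (Set.mem_univ (f n))
    exact hβ n hn (not_lt.1 hN) hβn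
  obtain ⟨β, hβ⟩ := exists_forall_lt_of_countable (Set.countable_iUnion hcount)
  refine ⟨β, fun N => ?_⟩
  by_contra! h
  exact lt_irrefl β (hβ β (Set.mem_iUnion.2 ⟨N, h⟩))

/-- The binary digits of a natural number, least significant first. -/
def binaryDigit (s i : ℕ) : Fin 2 := if s.testBit i then 1 else 0

theorem exists_binaryDigit_eq (z : ℕ → Fin 2) (m : ℕ) : ∃ s, ∀ i < m, binaryDigit s i = z i := by
  refine ⟨Nat.ofBits fun i : Fin m => decide (z i = 1), fun i hi => ?_⟩
  rw [binaryDigit, Nat.testBit_ofBits_lt _ _ hi]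
  have : z i = 0 ∨ z i = 1 := by generalize z i = a; fin_cases a <;> simp
  rcases this with h | h <;> simp [h]

/-- For a dense open set `U` and a position `n`, there is a finite block of binary digits which
forces a real into `U` when it occurs at position `n`, whatever the digits before it are. -/
theorem exists_block_mem {U : Set ℝ} (hU : IsOpen U) (hd : Dense U) (n : ℕ) :
    ∃ m s, ∀ z : ℕ → Fin 2, (∀ i < m, z (n + i) = binaryDigit s i) → Real.ofDigits z ∈ U := by
  let φ (t : Fin n → Fin 2) (u : ℝ) : ℝ :=
    ∑ i, (t i : ℝ) * (((2 : ℕ) : ℝ) ^ ((i : ℕ) + 1))⁻¹ + (((2 : ℕ) : ℝ) ^ n)⁻¹ * u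
  have hφc (t) : Continuous (φ t) := by fun_prop
  have hφo (t) : IsOpenMap (φ t) :=
    (Homeomorph.addLeft _).isOpenMap.comp
      (Homeomorph.mulLeft₀ (((2 : ℕ) : ℝ) ^ n)⁻¹ (by positivity)).isOpenMap
  have hVo : IsOpen (⋂ t, φ t ⁻¹' U) := isOpen_iInter_of_finite fun t => hU.preimage (hφc t)
  have hVd : Dense (⋂ t, φ t ⁻¹' U) :=
    dense_iInter_of_isOpen (fun t => hU.preimage (hφc t)) fun t => hd.preimage (hφo t)
  obtain ⟨u, hu, huV⟩ := hVd.inter_open_nonempty (Set.Ioo 0 1) isOpen_Ioo (by simp)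
  have hz₀ : Real.ofDigits (Real.digits u 2) = u :=
    Real.ofDigits_digits (by norm_num) ⟨hu.1.le, hu.2⟩
  obtain ⟨I, W, hW, hIW⟩ := isOpen_pi_iff.1 (hVo.preimage Real.continuous_ofDigits)
    (Real.digits u 2) (by rw [Set.mem_preimage, hz₀]; exact huV)
  obtain ⟨s, hs⟩ := exists_binaryDigit_eq (Real.digits u 2) (I.sup id + 1)
  refine ⟨I.sup id + 1, s, fun z hz => ?_⟩
  have htail : (fun i => z (i + n)) ∈ Real.ofDigits ⁻¹' ⋂ t, φ t ⁻¹' U := by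
    refine hIW fun i hi => ?_
    have hlt : i < I.sup id + 1 := Nat.lt_succ_of_le (Finset.le_sup (f := id) hi)
    simp only [add_comm i n, hz i hlt, hs i hlt]
    exact (hW i hi).2
  have := Set.mem_iInter.1 htail fun i => z i
  rw [Real.ofDigits_eq_sum_add_ofDigits z n, Finset.sum_range]
  exact this

/-- The starting points of consecutive blocks of digits. Each one exceeds the values of `x` at all
arguments up to the preceding one. -/
def blockStart (x : ℕ → ℕ) : ℕ → ℕ
  | 0 => 0
  | j + 1 => blockStart x j + 1 + ∑ i ∈ Finset.range (blockStart x j + 1), x i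

theorem blockStart_strictMono (x : ℕ → ℕ) : StrictMono (blockStart x) :=
  strictMono_nat_of_lt_succ fun j => by rw [blockStart]; omega

theorem le_blockStart_succ {x : ℕ → ℕ} {n j : ℕ} (h : n ≤ blockStart x j) :
    x n ≤ blockStart x (j + 1) := by
  rw [blockStart]
  have := Finset.single_le_sum (f := x) (s := Finset.range (blockStart x j + 1))
    (fun _ _ => Nat.zero_le _) (Finset.mem_range.2 (Nat.lt_succ_of_le h))
  omega

/-- The starting point of the block containing `i`. -/
def blockStartOf (x : ℕ → ℕ) (i : ℕ) : ℕ :=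
  blockStart x (Nat.findGreatest (fun j => blockStart x j ≤ i) i)

theorem blockStartOf_eq {x : ℕ → ℕ} {i j : ℕ} (h₁ : blockStart x j ≤ i)
    (h₂ : i < blockStart x (j + 1)) : blockStartOf x i = blockStart x j := by
  rw [blockStartOf]
  congr 1
  rw [Nat.findGreatest_eq_iff]
  refine ⟨((blockStart_strictMono x).le_apply).trans h₁, fun _ => h₁, fun n hn _ hle => ?_⟩
  have := (blockStart_strictMono x).monotone (Nat.succ_le_of_lt hn)
  exact absurd (h₂.trans_le this) (not_lt.2 hle)

/-- If `x` is at least `F ∘ F` at infinitely many places, then infinitely many blocks are as long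
as `F` asks for: when `x n ≥ F (F n)`, either the block containing `n` or the next one is. -/
theorem infinite_long_blocks {x F : ℕ → ℕ} (hF : Monotone F)
    (hx : ∀ N, ∃ n ≥ N, F (F n) ≤ x n) :
    {d | ∃ j, d = blockStart x j ∧ F d ≤ blockStart x (j + 1)}.Infinite := by
  refine Set.infinite_of_forall_exists_gt fun N => ?_
  obtain ⟨n, hn, hxn⟩ := hx (blockStart x (N + 1))
  have hmono := (blockStart_strictMono x).monotone
  have hex : ∃ j, n < blockStart x (j + 1) :=
    ⟨n, (Nat.lt_succ_self n).trans_le (blockStart_strictMono x).le_apply⟩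
  classical
  obtain ⟨j, hj, hjmin⟩ : ∃ j, n < blockStart x (j + 1) ∧ blockStart x j ≤ n := by
    refine ⟨Nat.find hex, Nat.find_spec hex, ?_⟩
    rcases h : Nat.find hex with _ | k
    · simp [blockStart]
    · exact not_lt.1 (Nat.find_min hex (m := k) (by omega))
  have hNj : N + 1 ≤ j := by
    have := (blockStart_strictMono x).lt_iff_lt.1 (hn.trans_lt hj)
    omega
  have hle (i) : i ≤ blockStart x i := (blockStart_strictMono x).le_apply
  rcases le_total (F n) (blockStart x (j + 1)) with h | h
  · exact ⟨blockStart x j, ⟨j, rfl, (hF hjmin).trans h⟩, by have := hle j; omega⟩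
  · refine ⟨blockStart x (j + 1), ⟨j + 1, rfl, (hF h).trans (hxn.trans ?_)⟩,
      by have := hle (j + 1); omega⟩
    exact le_blockStart_succ hj.le

/-- The real whose binary digits are, on each block given by `x`, those of the number that `x'`
takes as value at the starting point of the block. -/
noncomputable def blockReal (x x' : ℕ → ℕ) : ℝ :=
  Real.ofDigits fun i => binaryDigit (x' (blockStartOf x i)) (i - blockStartOf x i)

/-- Suppose that the reals `blockReal (x α) (x β)` avoid an intersection of dense open sets `U i`.
For a suitable `α` there are infinitely many starting points `n` of blocks that have room for the
digits `s n` forcing a real into `U 0, …, U n`. A suitable `β` has the value `s n` at infinitely many of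
these `n`, so that `blockReal (x α) (x β)` is in every `U i`. -/
theorem WeakEHMColoring.nonMeager_eq (H : WeakEHMColoring) : nonMeager = ℵ₁ := by
  refine le_antisymm ?_ aleph_one_le_nonMeager
  obtain ⟨x, hx⟩ := H.exists_guess
  have hcard : #(Set.range fun p : Omega1 × Omega1 => blockReal (x p.1) (x p.2)) ≤ ℵ₁ := by
    refine Cardinal.mk_range_le.trans ?_
    simp [Cardinal.mul_eq_self (Cardinal.aleph0_le_aleph 1)]
  refine (csInf_le' ⟨_, fun hmeagre => ?_, rfl⟩ : nonMeager ≤ _).trans hcard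
  obtain ⟨t, hts, htG, htd⟩ := mem_residual.1 hmeagre
  obtain ⟨U, hUo, rfl⟩ := htG.eq_iInter_nat
  have hblock (n : ℕ) := exists_block_mem (U := ⋂ i ∈ Set.Iic n, U i)
    ((Set.finite_Iic n).isOpen_biInter fun i _ => hUo i)
    (htd.mono (Set.iInter_mono fun i => Set.subset_iInter fun _ => subset_rfl)) n
  choose m s hms using hblock
  let F (n : ℕ) : ℕ := ∑ i ∈ Finset.range (n + 1), (i + m i)
  have hF : Monotone F := fun n n' h =>
    Finset.sum_le_sum_of_subset (Finset.range_mono (Nat.succ_le_succ h))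
  have hmF (n) : n + m n ≤ F n :=
    Finset.single_le_sum (f := fun i => i + m i) (fun _ _ => Nat.zero_le _)
      (Finset.self_mem_range_succ n)
  obtain ⟨α, hα⟩ := hx (fun n => F (F n)) Set.univ Set.infinite_univ
  obtain ⟨β, hβ⟩ := hx s _ (infinite_long_blocks (x := x α) hF fun N =>
    (hα N).imp fun n hn => ⟨hn.2.1, hn.2.2.ge⟩)
  refine hts (Set.mem_iInter.2 fun N => ?_) ⟨(α, β), rfl⟩
  obtain ⟨n, ⟨j, hj, hFn⟩, hNn, hβn⟩ := hβ N
  refine Set.mem_iInter₂.1 (hms n _ fun i hi => ?_) N hNn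
  have hstart : blockStartOf (x α) (n + i) = n := by
    rw [hj]
    refine blockStartOf_eq (Nat.le_add_right _ _) ?_
    rw [← hj]
    have := hmF n
    omega
  simp only [hstart, hβn, Nat.add_sub_cancel_left]

/-! ### The equivalence -/

theorem theorem3p1 :
    List.TFAE
      [nonMeager = ℵ₁,
        SierpinskiPrinciple,
        SierpinskiPrincipleFinite,
        GalvinColoring,
        ∀ p : Omega1 → Omega1 → ℕ, IsLInftyCoherent p → StrongColoringOver p,
        WeakEHMColoring,
        InfinitelyOftenEqualFamily] := by
  tfae_have 1 → 7 := infinitelyOftenEqualFamily_of_nonMeager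
  tfae_have 7 → 3 := fun H => H.sierpinskiPrincipleFinite
  tfae_have 7 → 4 := fun H => H.galvinColoring
  tfae_have 7 → 5 := fun H _ hp => H.strongColoringOver hp
  tfae_have 3 → 2 := fun H => H.sierpinskiPrinciple
  tfae_have 4 → 2 := fun H => H.sierpinskiPrinciple
  tfae_have 2 → 7 := fun H => H.infinitelyOftenEqualFamily
  tfae_have 5 → 6 := fun H =>
    (H (fun _ _ => 0) fun β β' _ => (Set.finite_singleton 0).subset
      (by rintro _ ⟨α, -, rfl⟩; simp)).weakEHMColoring
  tfae_have 6 → 1 := fun H => H.nonMeager_eq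
  tfae_finish
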